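/- Let $F$ be a field of characteristic $5$. Let $A(2)=F[x_1,x_2]/(x_1^5,x_2^5)$ and let $W(2)=\mathrm{Der}_F A(2)$, a free $A(2)$-module with basis $D_1=\partial/\partial x_1$, $D_2=\partial/\partial x_2$; put $\mathrm{div}(f_1D_1+f_2D_2)=D_1(f_1)+D_2(f_2)$. Let $\widetilde{W(2)}=\{\widetilde{D} : D\in W(2)\}$ be a copy of $W(2)$. The (restricted) Melikian algebra is the $F$-Lie algebra $$M=A(2)\oplus W(2)\oplus\widetilde{W(2)}$$ whose bracket extends the commutator bracket of $W(2)$ and is given, for $D,E\in W(2)$ and $f,g,f_i,g_i\in A(2)$, by $$[D,\widetilde{E}]=\widetilde{[D,E]}+2\,\mathrm{div}(D)\widetilde{E},\qquad [D,f]=D(f)-2\,\mathrm{div}(D)f,\qquad [f,\widetilde{E}]=fE,$$ $$[f_1\widetilde{D_1}+f_2\widetilde{D_2},\,g_1\widetilde{D_1}+g_2\widetilde{D_2}]=f_1g_2-f_2g_1,$$ $$[f,g]=2\,(gD_2(f)-fD_2(g))\widetilde{D_1}+2\,(fD_1(g)-gD_1(f))\widetilde{D_2}.$$ Then the first (Chevalley--Eilenberg)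 cohomology group of $M$ with coefficients in the adjoint representation vanishes, $$H^1(M,M)=0;$$ equivalently, every $F$-linear derivation $\delta$ of the Lie algebra $M$ is inner, that is, $\delta=[m,\cdot\,]$ for some $m\in M$. -/

import Mathlib

set_option linter.unusedSimpArgs false

noncomputable section

namespace Melikian

/-- The ideal `(x₁⁵, x₂⁵)` of `F[x₁, x₂]`. -/
def truncIdeal (F : Type*) [Field F] : Ideal (MvPolynomial (Fin 2) F) :=
  Ideal.span (Set.range fun i : Fin 2 => (MvPolynomial.X i : MvPolynomial (Fin 2) F) ^ 5)

/-- The algebra `A(2) = F[x₁, x₂] / (x₁⁵, x₂⁵)` of truncated polynomials. -/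
def A (F : Type*) [Field F] : Type _ := MvPolynomial (Fin 2) F ⧸ truncIdeal F

instance (F : Type*) [Field F] : CommRing (A F) :=
  inferInstanceAs (CommRing (MvPolynomial (Fin 2) F ⧸ truncIdeal F))

instance (F : Type*) [Field F] : Algebra F (A F) :=
  inferInstanceAs (Algebra F (MvPolynomial (Fin 2) F ⧸ truncIdeal F))

/-- The quotient map `F[x₁, x₂] → A(2)`. -/
def mk (F : Type*) [Field F] : MvPolynomial (Fin 2) F →ₐ[F] A F :=
  Ideal.Quotient.mkₐ F (truncIdeal F)

theorem mk_surjective (F : Type*) [Field F] : Function.Surjective (mk F) :=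
  Ideal.Quotient.mkₐ_surjective F (truncIdeal F)

theorem mk_eq_zero (F : Type*) [Field F] (f : MvPolynomial (Fin 2) F) :
    mk F f = 0 ↔ f ∈ truncIdeal F :=
  Ideal.Quotient.eq_zero_iff_mem

/-- The Witt-Jacobson Lie algebra `W(2) = Der_F A(2)`; its bracket is the commutator. -/
abbrev W (F : Type*) [Field F] : Type _ := Derivation F (A F) (A F)

/-- The classes of the two variables in `A(2)` (the index runs through `0, 1`). -/
def x (F : Type*) [Field F] (i : Fin 2) : A F := mk F (MvPolynomial.X i)

theorem five_eq_zero (F : Type*) [Field F] [CharP F 5] : (5 : A F) = 0 := by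
  have h : ((5 : ℕ) : F) = 0 := CharP.cast_eq_zero F 5
  have h' := congrArg (algebraMap F (A F)) h
  rwa [map_natCast, map_zero] at h'

theorem pderiv_mem (F : Type*) [Field F] [CharP F 5] (i : Fin 2) (f : MvPolynomial (Fin 2) F)
    (hf : f ∈ truncIdeal F) : MvPolynomial.pderiv i f ∈ truncIdeal F := by
  have h5 : (5 : MvPolynomial (Fin 2) F) = 0 := by
    have h : ((5 : ℕ) : F) = 0 := CharP.cast_eq_zero F 5
    have h' := congrArg (algebraMap F (MvPolynomial (Fin 2) F)) h
    rwa [map_natCast, map_zero] at h'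
  unfold truncIdeal at hf
  induction hf using Submodule.span_induction with
  | mem y hy =>
    obtain ⟨j, rfl⟩ := hy
    simp [Derivation.leibniz_pow, h5]
  | zero => simp
  | add y z _ _ hy hz => rw [map_add]; exact add_mem hy hz
  | smul a y hy h =>
    rw [smul_eq_mul, Derivation.leibniz, smul_eq_mul, smul_eq_mul]
    exact add_mem (Ideal.mul_mem_left _ _ h) (Ideal.mul_mem_right _ _ hy)

/-- The partial derivatives `D₁ = ∂/∂x₁`, `D₂ = ∂/∂x₂` of `A(2)`, induced by those of `F[x₁, x₂]`
(the index runs through `0, 1`). -/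
def D (F : Type*) [Field F] [CharP F 5] (i : Fin 2) : W F :=
  Derivation.liftOfSurjective (mk_surjective F) (d := MvPolynomial.pderiv i)
    fun f hf => (mk_eq_zero F _).mpr (pderiv_mem F i f ((mk_eq_zero F f).mp hf))

theorem D_mk (F : Type*) [Field F] [CharP F 5] (i : Fin 2) (f : MvPolynomial (Fin 2) F) :
    D F i (mk F f) = mk F (MvPolynomial.pderiv i f) :=
  Derivation.liftOfSurjective_apply (mk_surjective F)
    (fun f hf => (mk_eq_zero F _).mpr (pderiv_mem F i f ((mk_eq_zero F f).mp hf))) f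

theorem D_x (F : Type*) [Field F] [CharP F 5] (i j : Fin 2) :
    D F i (x F j) = if i = j then 1 else 0 := by
  rw [x, D_mk, MvPolynomial.pderiv_X]
  by_cases h : i = j
  · subst h; simp
  · simp [h, Ne.symm h]

theorem W_ext (F : Type*) [Field F] {E E' : W F} (h : ∀ i, E (x F i) = E' (x F i)) : E = E' := by
  ext f
  obtain ⟨f, rfl⟩ := mk_surjective F f
  induction f using MvPolynomial.induction_on with
  | C a =>
    have : mk F (MvPolynomial.C a) = algebraMap F (A F) a := (mk F).commutes a
    rw [this, Derivation.map_algebraMap, Derivation.map_algebraMap]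
  | add p q hp hq => rw [map_add, map_add, map_add, hp, hq]
  | mul_X p i hp =>
    have hi := h i
    rw [x] at hi
    rw [map_mul, Derivation.leibniz, Derivation.leibniz, hp, hi]

/-- `D₁, D₂` generate `W(2)` over `A(2)`; the coordinates of `E` are `E(x₁), E(x₂)`. -/
theorem W_apply (F : Type*) [Field F] [CharP F 5] (E : W F) (f : A F) :
    E f = E (x F 0) * D F 0 f + E (x F 1) * D F 1 f := by
  have : E = E (x F 0) • D F 0 + E (x F 1) • D F 1 := by
    apply W_ext
    intro i
    fin_cases i <;> simp [D_x]
  exact DFunLike.congr_fun this f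

theorem D_comm (F : Type*) [Field F] [CharP F 5] (f : A F) :
    D F 1 (D F 0 f) = D F 0 (D F 1 f) := by
  have : ⁅D F 1, D F 0⁆ = 0 := by
    apply W_ext
    intro i
    fin_cases i <;> simp [D_x, Derivation.commutator_apply]
  have := DFunLike.congr_fun this f
  simpa [Derivation.commutator_apply, sub_eq_zero] using this

/-- The divergence `div(f₁D₁ + f₂D₂) = D₁(f₁) + D₂(f₂)`; the coordinates of `E = f₁D₁ + f₂D₂`
are `fᵢ = E(xᵢ)`. -/
def div (F : Type*) [Field F] [CharP F 5] (E : W F) : A F := D F 0 (E (x F 0)) + D F 1 (E (x F 1))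

/-- The underlying vector space `A(2) ⊕ W(2) ⊕ W(2)~` of the Melikian algebra, where `W(2)~` is a
copy of `W(2)`. The triple `⟨f, E, G⟩` stands for `f + E + G~`. -/
@[ext]
structure M (F : Type*) [Field F] where
  /-- The component in `A(2)`. -/
  fn : A F
  /-- The component in `W(2)`. -/
  vf : W F
  /-- The component in the copy of `W(2)`. -/
  tvf : W F

/-- The identification of `A(2) ⊕ W(2) ⊕ W(2)~` with the product, along which the vector space
structure is transported. -/
def M.equivProd (F : Type*) [Field F] : M F ≃ A F × W F × W F where
  toFun a := (a.fn, a.vf, a.tvf)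
  invFun p := ⟨p.1, p.2.1, p.2.2⟩
  left_inv _ := rfl
  right_inv _ := rfl

instance (F : Type*) [Field F] : AddCommGroup (M F) := (M.equivProd F).addCommGroup

instance (F : Type*) [Field F] : Module F (M F) := (M.equivProd F).module F

/-- The bracket of the Melikian algebra: the bilinear alternating extension of
`[E, E']` the commutator in `W(2)`,
`[E, G~] = [E, G]~ + 2 div(E) G~`,
`[E, f] = E(f) - 2 div(E) f`,
`[f₁D₁~ + f₂D₂~, g₁D₁~ + g₂D₂~] = f₁g₂ - f₂g₁`,
`[f, G~] = f G`,
`[f, g] = 2 (g D₂(f) - f D₂(g)) D₁~ + 2 (f D₁(g) - g D₁(f)) D₂~`. -/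
def bracket (F : Type*) [Field F] [CharP F 5] (a b : M F) : M F :=
  { fn := (a.vf b.fn - 2 * div F a.vf * b.fn) - (b.vf a.fn - 2 * div F b.vf * a.fn)
      + (a.tvf (x F 0) * b.tvf (x F 1) - a.tvf (x F 1) * b.tvf (x F 0))
    vf := ⁅a.vf, b.vf⁆ + a.fn • b.tvf - b.fn • a.tvf
    tvf := (⁅a.vf, b.tvf⁆ + (2 * div F a.vf) • b.tvf)
      - (⁅b.vf, a.tvf⁆ + (2 * div F b.vf) • a.tvf)
      + (2 * (b.fn * D F 1 a.fn - a.fn * D F 1 b.fn)) • D F 0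
      + (2 * (a.fn * D F 0 b.fn - b.fn * D F 0 a.fn)) • D F 1 }

theorem M_ext (F : Type*) [Field F] {a b : M F} (h₁ : a.fn = b.fn)
    (h₂ : ∀ i, a.vf (x F i) = b.vf (x F i)) (h₃ : ∀ i, a.tvf (x F i) = b.tvf (x F i)) : a = b :=
  M.ext h₁ (W_ext F h₂) (W_ext F h₃)

section BracketLaws

variable (F : Type*) [Field F]

theorem add_1 (a b : M F) : (a + b).fn = a.fn + b.fn := rfl
theorem add_2 (a b : M F) : (a + b).vf = a.vf + b.vf := rfl
theorem add_3 (a b : M F) : (a + b).tvf = a.tvf + b.tvf := rfl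
theorem zero_1 : (0 : M F).fn = 0 := rfl
theorem zero_2 : (0 : M F).vf = 0 := rfl
theorem zero_3 : (0 : M F).tvf = 0 := rfl
theorem smul_1 (c : F) (a : M F) : (c • a).fn = c • a.fn := rfl
theorem smul_2 (c : F) (a : M F) : (c • a).vf = c • a.vf := rfl
theorem smul_3 (c : F) (a : M F) : (c • a).tvf = c • a.tvf := rfl

variable [CharP F 5]

theorem D_two (i : Fin 2) : D F i 2 = 0 := by
  have := (D F i).map_natCast 2
  simpa using this

/-- The `A(2)`-component of the bracket, in coordinates. -/
theorem bracket_1 (a b : M F) : (bracket F a b).fn =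
    (a.vf (x F 0) * D F 0 b.fn + a.vf (x F 1) * D F 1 b.fn
      - 2 * (D F 0 (a.vf (x F 0)) + D F 1 (a.vf (x F 1))) * b.fn)
    - (b.vf (x F 0) * D F 0 a.fn + b.vf (x F 1) * D F 1 a.fn
      - 2 * (D F 0 (b.vf (x F 0)) + D F 1 (b.vf (x F 1))) * a.fn)
    + (a.tvf (x F 0) * b.tvf (x F 1) - a.tvf (x F 1) * b.tvf (x F 0)) := by
  rw [← W_apply F a.vf, ← W_apply F b.vf]
  rfl

/-- The `W(2)`-component of the bracket, in coordinates. -/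
theorem bracket_2 (a b : M F) (i : Fin 2) : (bracket F a b).vf (x F i) =
    (a.vf (x F 0) * D F 0 (b.vf (x F i)) + a.vf (x F 1) * D F 1 (b.vf (x F i)))
    - (b.vf (x F 0) * D F 0 (a.vf (x F i)) + b.vf (x F 1) * D F 1 (a.vf (x F i)))
    + a.fn * b.tvf (x F i) - b.fn * a.tvf (x F i) := by
  rw [← W_apply F a.vf, ← W_apply F b.vf]
  rfl

/-- The `W(2)~`-component of the bracket, in coordinates. -/
theorem bracket_3 (a b : M F) (i : Fin 2) : (bracket F a b).tvf (x F i) =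
    (a.vf (x F 0) * D F 0 (b.tvf (x F i)) + a.vf (x F 1) * D F 1 (b.tvf (x F i))
      - (b.tvf (x F 0) * D F 0 (a.vf (x F i)) + b.tvf (x F 1) * D F 1 (a.vf (x F i)))
      + 2 * (D F 0 (a.vf (x F 0)) + D F 1 (a.vf (x F 1))) * b.tvf (x F i))
    - (b.vf (x F 0) * D F 0 (a.tvf (x F i)) + b.vf (x F 1) * D F 1 (a.tvf (x F i))
      - (a.tvf (x F 0) * D F 0 (b.vf (x F i)) + a.tvf (x F 1) * D F 1 (b.vf (x F i)))
      + 2 * (D F 0 (b.vf (x F 0)) + D F 1 (b.vf (x F 1))) * a.tvf (x F i))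
    + 2 * (b.fn * D F 1 a.fn - a.fn * D F 1 b.fn) * D F 0 (x F i)
    + 2 * (a.fn * D F 0 b.fn - b.fn * D F 0 a.fn) * D F 1 (x F i) := by
  rw [← W_apply F a.vf, ← W_apply F b.vf, ← W_apply F a.tvf, ← W_apply F b.tvf]
  rfl

set_option maxHeartbeats 4000000 in
theorem jacobi_1 (a b c : M F) : (bracket F a (bracket F b c)).fn -
    ((bracket F (bracket F a b) c).fn + (bracket F b (bracket F a c)).fn) = 0 := by
  have h5 := five_eq_zero F
  have h10 : (10 : A F) = 0 := by linear_combination 2 * h5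
  have h15 : (15 : A F) = 0 := by linear_combination 3 * h5
  have h20 : (20 : A F) = 0 := by linear_combination 4 * h5
  simp only [bracket_1, bracket_2, bracket_3, D_x, map_add, map_sub, Derivation.leibniz, D_two,
    smul_eq_mul, D_comm, zero_ne_one, one_ne_zero, if_true, if_false, map_zero, mul_zero,
    zero_mul, add_zero, zero_add, sub_zero, Derivation.map_one_eq_zero, mul_one]
  ring_nf
  try simp only [h5, h10, h15, h20, mul_zero, add_zero, sub_zero, zero_add, neg_zero]

set_option maxHeartbeats 4000000 in
theorem jacobi_2 (a b c : M F) (i : Fin 2) : (bracket F a (bracket F b c)).vf (x F i) -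
    ((bracket F (bracket F a b) c).vf (x F i) + (bracket F b (bracket F a c)).vf (x F i)) = 0 := by
  have h5 := five_eq_zero F
  have h10 : (10 : A F) = 0 := by linear_combination 2 * h5
  have h15 : (15 : A F) = 0 := by linear_combination 3 * h5
  have h20 : (20 : A F) = 0 := by linear_combination 4 * h5
  obtain rfl | rfl : i = 0 ∨ i = 1 := by omega
  · simp only [bracket_1, bracket_2, bracket_3, D_x, map_add, map_sub, Derivation.leibniz, D_two,
      smul_eq_mul, D_comm, zero_ne_one, one_ne_zero, if_true, if_false, map_zero, mul_zero,
      zero_mul, add_zero, zero_add, sub_zero, Derivation.map_one_eq_zero, mul_one]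
    ring_nf
    try simp only [h5, h10, h15, h20, mul_zero, add_zero, sub_zero, zero_add, neg_zero]
  · simp only [bracket_1, bracket_2, bracket_3, D_x, map_add, map_sub, Derivation.leibniz, D_two,
      smul_eq_mul, D_comm, zero_ne_one, one_ne_zero, if_true, if_false, map_zero, mul_zero,
      zero_mul, add_zero, zero_add, sub_zero, Derivation.map_one_eq_zero, mul_one]
    ring_nf
    try simp only [h5, h10, h15, h20, mul_zero, add_zero, sub_zero, zero_add, neg_zero]

set_option maxHeartbeats 4000000 in
theorem jacobi_3 (a b c : M F) (i : Fin 2) : (bracket F a (bracket F b c)).tvf (x F i) -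
    ((bracket F (bracket F a b) c).tvf (x F i) + (bracket F b (bracket F a c)).tvf (x F i)) = 0 := by
  have h5 := five_eq_zero F
  have h10 : (10 : A F) = 0 := by linear_combination 2 * h5
  have h15 : (15 : A F) = 0 := by linear_combination 3 * h5
  have h20 : (20 : A F) = 0 := by linear_combination 4 * h5
  obtain rfl | rfl : i = 0 ∨ i = 1 := by omega
  · simp only [bracket_1, bracket_2, bracket_3, D_x, map_add, map_sub, Derivation.leibniz, D_two,
      smul_eq_mul, D_comm, zero_ne_one, one_ne_zero, if_true, if_false, map_zero, mul_zero,
      zero_mul, add_zero, zero_add, sub_zero, Derivation.map_one_eq_zero, mul_one]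
    ring_nf
    try simp only [h5, h10, h15, h20, mul_zero, add_zero, sub_zero, zero_add, neg_zero]
  · simp only [bracket_1, bracket_2, bracket_3, D_x, map_add, map_sub, Derivation.leibniz, D_two,
      smul_eq_mul, D_comm, zero_ne_one, one_ne_zero, if_true, if_false, map_zero, mul_zero,
      zero_mul, add_zero, zero_add, sub_zero, Derivation.map_one_eq_zero, mul_one]
    ring_nf
    try simp only [h5, h10, h15, h20, mul_zero, add_zero, sub_zero, zero_add, neg_zero]

theorem bracket_add_left (a b c : M F) :
    bracket F (a + b) c = bracket F a c + bracket F b c := by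
  apply M_ext
  · simp only [bracket_1, add_1, add_2, add_3, Derivation.add_apply, map_add]; ring
  · intro i
    simp only [bracket_2, add_1, add_2, add_3, Derivation.add_apply, map_add]; ring
  · intro i
    simp only [bracket_3, add_1, add_2, add_3, Derivation.add_apply, map_add]; ring

theorem bracket_add_right (a b c : M F) :
    bracket F a (b + c) = bracket F a b + bracket F a c := by
  apply M_ext
  · simp only [bracket_1, add_1, add_2, add_3, Derivation.add_apply, map_add]; ring
  · intro i
    simp only [bracket_2, add_1, add_2, add_3, Derivation.add_apply, map_add]; ring
  · intro i
    simp only [bracket_3, add_1, add_2, add_3, Derivation.add_apply, map_add]; ring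

theorem bracket_self (a : M F) : bracket F a a = 0 := by
  apply M_ext
  · rw [bracket_1, zero_1]; ring
  · intro i; rw [bracket_2, zero_2, Derivation.zero_apply]; ring
  · intro i; rw [bracket_3, zero_3, Derivation.zero_apply]; ring

theorem bracket_smul (t : F) (a b : M F) : bracket F a (t • b) = t • bracket F a b := by
  apply M_ext
  · simp only [bracket_1, smul_1, smul_2, smul_3, Derivation.smul_apply, map_smul, Algebra.smul_def,
      Derivation.leibniz, Derivation.map_algebraMap, smul_eq_mul,
      Algebra.algebraMap_self, RingHom.id_apply]
    ring
  · intro i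
    simp only [bracket_2, smul_1, smul_2, smul_3, Derivation.smul_apply, map_smul, Algebra.smul_def,
      Derivation.leibniz, Derivation.map_algebraMap, smul_eq_mul,
      Algebra.algebraMap_self, RingHom.id_apply]
    ring
  · intro i
    simp only [bracket_3, smul_1, smul_2, smul_3, Derivation.smul_apply, map_smul, Algebra.smul_def,
      Derivation.leibniz, Derivation.map_algebraMap, smul_eq_mul,
      Algebra.algebraMap_self, RingHom.id_apply]
    ring

theorem jacobi (a b c : M F) : bracket F a (bracket F b c) =
    bracket F (bracket F a b) c + bracket F b (bracket F a c) :=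
  M_ext F (sub_eq_zero.mp (jacobi_1 F a b c)) (fun i => sub_eq_zero.mp (jacobi_2 F a b c i))
    (fun i => sub_eq_zero.mp (jacobi_3 F a b c i))

/-- The restricted Melikian algebra as a Lie algebra over `F`. -/
instance : LieRing (M F) where
  bracket := bracket F
  add_lie := bracket_add_left F
  lie_add := bracket_add_right F
  lie_self := bracket_self F
  leibniz_lie := jacobi F

instance : LieAlgebra F (M F) where
  lie_smul := bracket_smul F

end BracketLaws

section Cohomology

variable (R L V : Type*) [CommRing R] [LieRing L] [LieAlgebra R L]
  [AddCommGroup V] [Module R V] [LieRingModule L V] [LieModule R L V]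

/-- The Chevalley-Eilenberg differential `C⁰(L, V) = V → C¹(L, V)`, `(d v)(y) = y · v`. -/
def d₀₁ : V →ₗ[R] LieModule.Cohomology.oneCochain R L V :=
  (LieModule.toEnd R L V : L →ₗ[R] Module.End R V).flip

/-- The 1-cocycles `Z¹(L, V)`: the kernel of `(d f)(y, z) = y · f(z) - z · f(y) - f([y, z])`. -/
def Z1 : Submodule R (LieModule.Cohomology.oneCochain R L V) :=
  LinearMap.ker (LieModule.Cohomology.d₁₂ R L V)

/-- The 1-coboundaries `B¹(L, V)`. -/
def B1 : Submodule R (LieModule.Cohomology.oneCochain R L V) :=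
  LinearMap.range (d₀₁ R L V)

theorem B1_le_Z1 : B1 R L V ≤ Z1 R L V := by
  rintro _ ⟨v, rfl⟩
  rw [Z1, LinearMap.mem_ker]
  ext y z
  simp [d₀₁]

/-- The first Chevalley-Eilenberg cohomology `H¹(L, V) = Z¹(L, V) / B¹(L, V)`. -/
abbrev H1 : Type _ := Z1 R L V ⧸ (B1 R L V).submoduleOf (Z1 R L V)

end Cohomology

end Melikian

end

noncomputable section

namespace Melikian

/-! ### Coordinates on `M` -/

variable {F : Type*} [Field F]

/-! Inner derivations are subtracted from a derivation δ until it kills D₁, D₂, x₁D₁ and x₂D₂; such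
a derivation is then shown to be zero.

D₁ and D₂ act on `M` by coordinatewise differentiation, so matching δ on them is a Poincaré lemma on
A(2): [D₁, D₂] = 0 makes the coordinates of δ(D₁), δ(D₂) closed. The obstruction in characteristic
5, that x⁴ has no primitive, is absent: expanding δ((ad Dᵢ)⁵) = 0 modulo 5 shows that (ad Dᵢ)⁴δ(Dᵢ)
is central, and the centre is zero (`lie_iterate_apply_eq_zero`, `exists_lie_eq_on_D`). The Euler
field x₁D₁ + x₂D₂ acts invertibly on the centralizer of D₁, D₂, the elements with constant
coordinates. Hence δ can also be made to kill the Euler field, and it then kills each xᵢDᵢ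
(`exists_lie_eq_on_D_euler`, `apply_xD_eq_zero`).

The normalized δ preserves weights for the torus spanned by x₁D₁, x₂D₂. By induction on the degree
of a monomial f, δ sends f, fDᵢ and fDᵢ~ to elements with constant coordinates. Weights modulo 5 and
brackets with 1, D₁~, D₂~ force these to vanish, except for fDᵢ~ in three bidegrees of total degree
6, where fDᵢ~ is instead a combination of brackets of killed elements (`kills_of_kills_D`,
`Kills.tvf_D_mul`, `kills_monomial`). -/

theorem ext_coord {a b : M F} (h : a.fn = b.fn) (h₁ : a.vf (x F 0) = b.vf (x F 0))
    (h₂ : a.vf (x F 1) = b.vf (x F 1)) (h₃ : a.tvf (x F 0) = b.tvf (x F 0))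
    (h₄ : a.tvf (x F 1) = b.tvf (x F 1)) : a = b :=
  M_ext F h (Fin.forall_fin_two.mpr ⟨h₁, h₂⟩) (Fin.forall_fin_two.mpr ⟨h₃, h₄⟩)

/-- The element `f + g₁D₁ + g₂D₂ + h₁D₁~ + h₂D₂~` of `M`. -/
def ofCoord [CharP F 5] (f g₁ g₂ h₁ h₂ : A F) : M F :=
  ⟨f, g₁ • D F 0 + g₂ • D F 1, h₁ • D F 0 + h₂ • D F 1⟩

theorem x_pow_five (i : Fin 2) : x F i ^ 5 = 0 := by
  rw [x, ← map_pow, mk_eq_zero]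
  exact Ideal.subset_span ⟨i, rfl⟩

variable [CharP F 5]

section Coordinates

variable (f g₁ g₂ h₁ h₂ : A F)

theorem ofCoord_fn : (ofCoord f g₁ g₂ h₁ h₂).fn = f := rfl

theorem ofCoord_vf_zero : (ofCoord f g₁ g₂ h₁ h₂).vf (x F 0) = g₁ := by
  simp [ofCoord, D_x]

theorem ofCoord_vf_one : (ofCoord f g₁ g₂ h₁ h₂).vf (x F 1) = g₂ := by
  simp [ofCoord, D_x]

theorem ofCoord_tvf_zero : (ofCoord f g₁ g₂ h₁ h₂).tvf (x F 0) = h₁ := by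
  simp [ofCoord, D_x]

theorem ofCoord_tvf_one : (ofCoord f g₁ g₂ h₁ h₂).tvf (x F 1) = h₂ := by
  simp [ofCoord, D_x]

end Coordinates

theorem eq_ofCoord (a : M F) :
    a = ofCoord a.fn (a.vf (x F 0)) (a.vf (x F 1)) (a.tvf (x F 0)) (a.tvf (x F 1)) := by
  apply ext_coord <;>
    simp only [ofCoord_fn, ofCoord_vf_zero, ofCoord_vf_one, ofCoord_tvf_zero, ofCoord_tvf_one]

theorem ofCoord_inj {f g₁ g₂ h₁ h₂ f' g₁' g₂' h₁' h₂' : A F} :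
    ofCoord f g₁ g₂ h₁ h₂ = ofCoord f' g₁' g₂' h₁' h₂' ↔
      f = f' ∧ g₁ = g₁' ∧ g₂ = g₂' ∧ h₁ = h₁' ∧ h₂ = h₂' := by
  constructor
  · intro h
    refine ⟨congrArg M.fn h, ?_, ?_, ?_, ?_⟩
    · simpa only [ofCoord_vf_zero] using congrArg (fun a : M F => a.vf (x F 0)) h
    · simpa only [ofCoord_vf_one] using congrArg (fun a : M F => a.vf (x F 1)) h
    · simpa only [ofCoord_tvf_zero] using congrArg (fun a : M F => a.tvf (x F 0)) h
    · simpa only [ofCoord_tvf_one] using congrArg (fun a : M F => a.tvf (x F 1)) h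
  · rintro ⟨rfl, rfl, rfl, rfl, rfl⟩
    rfl

theorem zero_eq_ofCoord : (0 : M F) = ofCoord 0 0 0 0 0 := eq_ofCoord 0

theorem ofCoord_add (f g₁ g₂ h₁ h₂ f' g₁' g₂' h₁' h₂' : A F) :
    ofCoord f g₁ g₂ h₁ h₂ + ofCoord f' g₁' g₂' h₁' h₂' =
      ofCoord (f + f') (g₁ + g₁') (g₂ + g₂') (h₁ + h₁') (h₂ + h₂') := by
  apply ext_coord <;> simp only [add_1, add_2, add_3, Derivation.add_apply, ofCoord_fn,
    ofCoord_vf_zero, ofCoord_vf_one, ofCoord_tvf_zero, ofCoord_tvf_one]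

theorem smul_ofCoord (c : F) (f g₁ g₂ h₁ h₂ : A F) :
    c • ofCoord f g₁ g₂ h₁ h₂ = ofCoord (c • f) (c • g₁) (c • g₂) (c • h₁) (c • h₂) := by
  apply ext_coord <;> simp only [smul_1, smul_2, smul_3, Derivation.smul_apply, ofCoord_fn,
    ofCoord_vf_zero, ofCoord_vf_one, ofCoord_tvf_zero, ofCoord_tvf_one]

/-- The bracket of `M` in coordinates. -/
theorem lie_ofCoord (f g₁ g₂ h₁ h₂ f' g₁' g₂' h₁' h₂' : A F) :
    ⁅ofCoord f g₁ g₂ h₁ h₂, ofCoord f' g₁' g₂' h₁' h₂'⁆ = ofCoord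
      ((g₁ * D F 0 f' + g₂ * D F 1 f' - 2 * (D F 0 g₁ + D F 1 g₂) * f')
        - (g₁' * D F 0 f + g₂' * D F 1 f - 2 * (D F 0 g₁' + D F 1 g₂') * f)
        + (h₁ * h₂' - h₂ * h₁'))
      ((g₁ * D F 0 g₁' + g₂ * D F 1 g₁') - (g₁' * D F 0 g₁ + g₂' * D F 1 g₁) + f * h₁' - f' * h₁)
      ((g₁ * D F 0 g₂' + g₂ * D F 1 g₂') - (g₁' * D F 0 g₂ + g₂' * D F 1 g₂) + f * h₂' - f' * h₂)
      ((g₁ * D F 0 h₁' + g₂ * D F 1 h₁' - (h₁' * D F 0 g₁ + h₂' * D F 1 g₁)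
          + 2 * (D F 0 g₁ + D F 1 g₂) * h₁')
        - (g₁' * D F 0 h₁ + g₂' * D F 1 h₁ - (h₁ * D F 0 g₁' + h₂ * D F 1 g₁')
          + 2 * (D F 0 g₁' + D F 1 g₂') * h₁)
        + 2 * (f' * D F 1 f - f * D F 1 f'))
      ((g₁ * D F 0 h₂' + g₂ * D F 1 h₂' - (h₁' * D F 0 g₂ + h₂' * D F 1 g₂)
          + 2 * (D F 0 g₁ + D F 1 g₂) * h₂')
        - (g₁' * D F 0 h₂ + g₂' * D F 1 h₂ - (h₁ * D F 0 g₂' + h₂ * D F 1 g₂')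
          + 2 * (D F 0 g₁' + D F 1 g₂') * h₂)
        + 2 * (f * D F 0 f' - f' * D F 0 f)) := by
  change bracket F _ _ = _
  apply ext_coord <;> simp only [bracket_1, bracket_2, bracket_3, D_x, ofCoord_fn,
    ofCoord_vf_zero, ofCoord_vf_one, ofCoord_tvf_zero, ofCoord_tvf_one, zero_ne_one, one_ne_zero,
    if_true, if_false] <;> ring

/-! ### Derivatives and primitives in A(2) -/

theorem D_pow_five (i : Fin 2) (f : A F) : D F i (D F i (D F i (D F i (D F i f)))) = 0 := by
  have h5 := five_eq_zero F
  obtain ⟨f, rfl⟩ := mk_surjective F f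
  induction f using MvPolynomial.induction_on with
  | C a =>
    have : mk F (MvPolynomial.C a) = algebraMap F (A F) a := (mk F).commutes a
    rw [this, Derivation.map_algebraMap]
    simp only [map_zero]
  | add p q hp hq => simp only [map_add, hp, hq, add_zero]
  | mul_X p j hp =>
    have hx : mk F (MvPolynomial.X j) = x F j := rfl
    rw [map_mul, hx]
    by_cases hij : i = j
    · simp only [Derivation.leibniz, map_add, smul_eq_mul, D_x, hij, if_true,
        mul_one] at hp ⊢
      -- Leibniz gives D⁵(xp) = xD⁵(p) + 5D⁴(p).
      linear_combination x F j * hp + D F j (D F j (D F j (D F j (mk F p)))) * h5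
    · simp only [Derivation.leibniz, smul_eq_mul, D_x, hij, if_false, mul_zero, zero_add, add_zero,
        hp]

/-- A primitive of `f` with respect to `D F i`, provided the fourth derivative vanishes. -/
def primitive (i : Fin 2) (f : A F) : A F :=
  x F i * f - 3 * x F i ^ 2 * D F i f + x F i ^ 3 * D F i (D F i f)
    + x F i ^ 4 * D F i (D F i (D F i f))

theorem D_natCast (i : Fin 2) (n : ℕ) : D F i (n : A F) = 0 := (D F i).map_natCast n

theorem D_three (i : Fin 2) : D F i 3 = 0 := by
  simpa using D_natCast (F := F) i 3

theorem D_four (i : Fin 2) : D F i 4 = 0 := by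
  simpa using D_natCast (F := F) i 4

/-- Repeated integration by parts: the summands of `primitive` are (-1)ᵏxᵏ⁺¹Dᵏ(f)/(k+1)!, with 1/2!,
1/3!, 1/4! equal to 3, 1, -1 modulo 5. The derivative telescopes to f up to a multiple of x⁴D⁴(f).
-/
theorem D_primitive (i : Fin 2) {f : A F} (hf : D F i (D F i (D F i (D F i f))) = 0) :
    D F i (primitive i f) = f := by
  have h5 := five_eq_zero F
  simp only [primitive, map_add, map_sub, Derivation.leibniz, Derivation.leibniz_pow, smul_eq_mul,
    D_x, if_true, hf, D_three, nsmul_eq_mul, mul_one, mul_zero]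
  push_cast
  linear_combination (-x F i * D F i f + x F i ^ 3 * D F i (D F i (D F i f))) * h5

theorem D_primitive_of_ne {i j : Fin 2} (hij : i ≠ j) {f : A F} (hf : D F i f = 0) :
    D F i (primitive j f) = 0 := by
  have hc (g : A F) : D F i (D F j g) = D F j (D F i g) := by
    have h1 := D_comm F g
    fin_cases i <;> fin_cases j <;> first | rfl | exact h1 | exact h1.symm
  simp only [primitive, map_add, map_sub, Derivation.leibniz, Derivation.leibniz_pow, smul_eq_mul,
    D_x, hij, if_false, hc, hf, D_three, mul_zero, map_zero, smul_zero, add_zero, sub_zero]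

/-- A natural number prime to five is cancellable in `A(2)`. -/
theorem eq_zero_of_natCast_mul {n : ℕ} (hn : ¬ 5 ∣ n) {f : A F} (h : (n : A F) * f = 0) :
    f = 0 := by
  have hn' : (n : F) ≠ 0 := fun h0 => hn ((CharP.cast_eq_zero_iff F 5 n).mp h0)
  have : (n : F) • f = 0 := by rw [Algebra.smul_def, map_natCast, h]
  exact (smul_eq_zero.mp this).resolve_left hn'

/-! ### The centralizer of D₁ and D₂ -/

theorem lie_D_zero (f g₁ g₂ h₁ h₂ : A F) :
    ⁅ofCoord (F := F) 0 1 0 0 0, ofCoord f g₁ g₂ h₁ h₂⁆ =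
      ofCoord (D F 0 f) (D F 0 g₁) (D F 0 g₂) (D F 0 h₁) (D F 0 h₂) := by
  rw [lie_ofCoord]
  simp

theorem lie_D_one (f g₁ g₂ h₁ h₂ : A F) :
    ⁅ofCoord (F := F) 0 0 1 0 0, ofCoord f g₁ g₂ h₁ h₂⁆ =
      ofCoord (D F 1 f) (D F 1 g₁) (D F 1 g₂) (D F 1 h₁) (D F 1 h₂) := by
  rw [lie_ofCoord]
  simp

/-- The coordinates of an element that commutes with `D₁` and `D₂` have zero derivatives. -/
theorem exists_coord_of_lie_D_eq_zero {z : M F} (h₀ : ⁅ofCoord (F := F) 0 1 0 0 0, z⁆ = 0)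
    (h₁ : ⁅ofCoord (F := F) 0 0 1 0 0, z⁆ = 0) :
    ∃ f g₁ g₂ k₁ k₂ : A F, z = ofCoord f g₁ g₂ k₁ k₂ ∧ (∀ i, D F i f = 0) ∧
      (∀ i, D F i g₁ = 0) ∧ (∀ i, D F i g₂ = 0) ∧ (∀ i, D F i k₁ = 0) ∧ ∀ i, D F i k₂ = 0 := by
  refine ⟨_, _, _, _, _, eq_ofCoord z, ?_⟩
  rw [eq_ofCoord z, lie_D_zero, zero_eq_ofCoord, ofCoord_inj] at h₀
  rw [eq_ofCoord z, lie_D_one, zero_eq_ofCoord, ofCoord_inj] at h₁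
  simp only [Fin.forall_fin_two]
  exact ⟨⟨h₀.1, h₁.1⟩, ⟨h₀.2.1, h₁.2.1⟩, ⟨h₀.2.2.1, h₁.2.2.1⟩, ⟨h₀.2.2.2.1, h₁.2.2.2.1⟩,
    h₀.2.2.2.2, h₁.2.2.2.2⟩

section Constants

variable {f g₁ g₂ h₁ h₂ : A F} (hf : ∀ i, D F i f = 0) (hg₁ : ∀ i, D F i g₁ = 0)
  (hg₂ : ∀ i, D F i g₂ = 0) (hh₁ : ∀ i, D F i h₁ = 0) (hh₂ : ∀ i, D F i h₂ = 0)

include hf hg₁ hg₂ hh₁ hh₂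

/-- The action of `x₁D₁` on elements with constant coordinates. -/
theorem lie_xD_zero_of_const : ⁅ofCoord (F := F) 0 (x F 0) 0 0 0, ofCoord f g₁ g₂ h₁ h₂⁆ =
    ofCoord (-2 * f) (-g₁) 0 h₁ (2 * h₂) := by
  rw [lie_ofCoord, ofCoord_inj]
  simp [hf, hg₁, hg₂, hh₁, hh₂, D_x]
  ring

/-- The action of `x₂D₂` on elements with constant coordinates. -/
theorem lie_xD_one_of_const : ⁅ofCoord (F := F) 0 0 (x F 1) 0 0, ofCoord f g₁ g₂ h₁ h₂⁆ =
    ofCoord (-2 * f) 0 (-g₂) (2 * h₁) h₂ := by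
  rw [lie_ofCoord, ofCoord_inj]
  simp [hf, hg₁, hg₂, hh₁, hh₂, D_x]
  ring

/-- The action of the Euler field on elements with constant coordinates. -/
theorem lie_euler_of_const : ⁅ofCoord (F := F) 0 (x F 0) (x F 1) 0 0, ofCoord f g₁ g₂ h₁ h₂⁆ =
    ofCoord f (-g₁) (-g₂) (3 * h₁) (3 * h₂) := by
  have h5 := five_eq_zero F
  rw [lie_ofCoord, ofCoord_inj]
  simp [hf, hg₁, hg₂, hh₁, hh₂, D_x]
  refine ⟨?_, ?_, ?_⟩
  · linear_combination -f * h5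
  · ring
  · ring

end Constants

/-- On elements with constant coordinates the Euler field has only the eigenvalues 1, -1 and 3, all
nonzero modulo 5. In particular the centre of `M` is zero. -/
theorem eq_zero_of_lie_euler {z : M F} (h₀ : ⁅ofCoord (F := F) 0 1 0 0 0, z⁆ = 0)
    (h₁ : ⁅ofCoord (F := F) 0 0 1 0 0, z⁆ = 0)
    (h : ⁅ofCoord (F := F) 0 (x F 0) (x F 1) 0 0, z⁆ = 0) : z = 0 := by
  obtain ⟨f, g₁, g₂, k₁, k₂, rfl, hf, hg₁, hg₂, hk₁, hk₂⟩ := exists_coord_of_lie_D_eq_zero h₀ h₁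
  rw [lie_euler_of_const hf hg₁ hg₂ hk₁ hk₂, zero_eq_ofCoord, ofCoord_inj] at h
  have h3 {k : A F} (hk : 3 * k = 0) : k = 0 := eq_zero_of_natCast_mul (n := 3) (by norm_num) hk
  rw [zero_eq_ofCoord, ofCoord_inj]
  exact ⟨h.1, neg_eq_zero.mp h.2.1, neg_eq_zero.mp h.2.2.1, h3 h.2.2.2.1, h3 h.2.2.2.2⟩

/-! ### Normalization by inner derivations -/

theorem five_nsmul_eq_zero (m : M F) : 5 • m = 0 := by
  have h : ((5 : ℕ) : F) = 0 := CharP.cast_eq_zero F 5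
  rw [← Nat.cast_smul_eq_nsmul F, h, zero_smul]

/-- If `(ad d)⁵ = 0`, then `(ad d)⁴ (δ d)` is central for each derivation `δ`. -/
theorem lie_iterate_apply_eq_zero (δ : LieDerivation F (M F) (M F)) {d : M F}
    (hd : ∀ y : M F, ⁅d, ⁅d, ⁅d, ⁅d, ⁅d, y⁆⁆⁆⁆⁆ = 0) (y : M F) :
    ⁅⁅d, ⁅d, ⁅d, ⁅d, δ d⁆⁆⁆⁆, y⁆ = 0 := by
  have h : δ ⁅d, ⁅d, ⁅d, ⁅d, ⁅d, y⁆⁆⁆⁆⁆ = 0 := by rw [hd, map_zero]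
  simp only [LieDerivation.apply_lie_eq_add, lie_add] at h
  rw [hd, zero_add] at h
  generalize δ d = u at h ⊢
  simp only [leibniz_lie d u, leibniz_lie d ⁅d, u⁆, leibniz_lie d ⁅d, ⁅d, u⁆⁆,
    leibniz_lie d ⁅d, ⁅d, ⁅d, u⁆⁆⁆, lie_add] at h
  have h5 (m : M F) := five_nsmul_eq_zero m
  -- With u = δ(d), the term [(ad d)ʲu, (ad d)⁴⁻ʲy] occurs binom(5, j+1) times: 5, 10, 10, 5, 1 for
  -- j = 0, …, 4. Only j = 4 survives modulo 5.
  linear_combination (norm := module) h - h5 ⁅⁅d, ⁅d, ⁅d, u⁆⁆⁆, ⁅d, y⁆⁆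
    - 2 • h5 ⁅⁅d, ⁅d, u⁆⁆, ⁅d, ⁅d, y⁆⁆⁆ - 2 • h5 ⁅⁅d, u⁆, ⁅d, ⁅d, ⁅d, y⁆⁆⁆⁆
    - h5 ⁅u, ⁅d, ⁅d, ⁅d, ⁅d, y⁆⁆⁆⁆⁆

/-- Every derivation agrees on `D₁, D₂` with an inner one. -/
theorem exists_lie_eq_on_D (δ : LieDerivation F (M F) (M F)) : ∃ m : M F,
    δ (ofCoord 0 1 0 0 0) = ⁅m, ofCoord (F := F) 0 1 0 0 0⁆ ∧
      δ (ofCoord 0 0 1 0 0) = ⁅m, ofCoord (F := F) 0 0 1 0 0⁆ := by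
  have key₀ := lie_iterate_apply_eq_zero δ (d := ofCoord 0 1 0 0 0) fun y => by
    rw [eq_ofCoord y]; simp only [lie_D_zero, D_pow_five, zero_eq_ofCoord]
  have key₁ := lie_iterate_apply_eq_zero δ (d := ofCoord 0 0 1 0 0) fun y => by
    rw [eq_ofCoord y]; simp only [lie_D_one, D_pow_five, zero_eq_ofCoord]
  have center {z : M F} (hz : ∀ y : M F, ⁅z, y⁆ = 0) : z = 0 :=
    eq_zero_of_lie_euler (by rw [← lie_skew, hz, neg_zero]) (by rw [← lie_skew, hz, neg_zero])
      (by rw [← lie_skew, hz, neg_zero])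
  have hu := center key₀
  have hv := center key₁
  -- Applying δ to [D₁, D₂] = 0 gives the integrability condition for the Poincaré lemma.
  have hc : δ ⁅ofCoord (F := F) 0 1 0 0 0, ofCoord (F := F) 0 0 1 0 0⁆ = 0 := by
    rw [lie_D_zero, ← map_zero δ, zero_eq_ofCoord]
    simp
  rw [LieDerivation.apply_lie_eq_sub, sub_eq_zero] at hc
  generalize δ (ofCoord 0 1 0 0 0) = u at *
  generalize δ (ofCoord 0 0 1 0 0) = v at *
  obtain ⟨f, g₁, g₂, h₁, h₂, rfl⟩ : ∃ f g₁ g₂ h₁ h₂ : A F, u = ofCoord f g₁ g₂ h₁ h₂ :=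
    ⟨_, _, _, _, _, eq_ofCoord u⟩
  obtain ⟨f', g₁', g₂', h₁', h₂', rfl⟩ : ∃ f g₁ g₂ h₁ h₂ : A F, v = ofCoord f g₁ g₂ h₁ h₂ :=
    ⟨_, _, _, _, _, eq_ofCoord v⟩
  simp only [lie_D_zero, lie_D_one, zero_eq_ofCoord, ofCoord_inj] at hu hv hc
  -- a primitive of `u` along `D₁`, corrected by one along `D₂` of the remaining part of `v`
  let r (f f' : A F) : A F := primitive 0 f + primitive 1 (f' - D F 1 (primitive 0 f))
  have hr {f f' : A F} (hf : D F 0 (D F 0 (D F 0 (D F 0 f))) = 0)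
      (hf' : D F 1 (D F 1 (D F 1 (D F 1 f'))) = 0) (hc : D F 0 f' = D F 1 f) :
      D F 0 (r f f') = f ∧ D F 1 (r f f') = f' := by
    -- By integrability the remaining part is killed by D₁, hence so is its primitive along D₂, and
    -- the D₁-derivative already matched is not disturbed.
    have e : D F 0 (f' - D F 1 (primitive 0 f)) = 0 := by
      rw [map_sub, ← D_comm, D_primitive 0 hf, hc, sub_self]
    constructor
    · rw [map_add, D_primitive 0 hf, D_primitive_of_ne zero_ne_one e, add_zero]
    · rw [map_add, D_primitive 1, add_sub_cancel]
      simp only [map_sub, hf', D_pow_five, sub_zero]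
  have a := hr hu.1 hv.1 hc.1
  have b := hr hu.2.1 hv.2.1 hc.2.1
  have c := hr hu.2.2.1 hv.2.2.1 hc.2.2.1
  have d := hr hu.2.2.2.1 hv.2.2.2.1 hc.2.2.2.1
  have e := hr hu.2.2.2.2 hv.2.2.2.2 hc.2.2.2.2
  refine ⟨-ofCoord (r f f') (r g₁ g₁') (r g₂ g₂') (r h₁ h₁') (r h₂ h₂'), ?_, ?_⟩
  · rw [neg_lie, lie_skew, lie_D_zero, a.1, b.1, c.1, d.1, e.1]
  · rw [neg_lie, lie_skew, lie_D_one, a.2, b.2, c.2, d.2, e.2]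

theorem lie_D_apply_eq_zero {δ : LieDerivation F (M F) (M F)} {d y : M F} (hd : δ d = 0)
    (h : δ ⁅d, y⁆ = 0) : ⁅d, δ y⁆ = 0 := by
  rwa [LieDerivation.apply_lie_eq_add, hd, zero_lie, add_zero] at h

/-- Every derivation agrees on `D₁, D₂` and the Euler field with an inner one. -/
theorem exists_lie_eq_on_D_euler (δ : LieDerivation F (M F) (M F)) : ∃ m : M F,
    δ (ofCoord 0 1 0 0 0) = ⁅m, ofCoord (F := F) 0 1 0 0 0⁆ ∧
      δ (ofCoord 0 0 1 0 0) = ⁅m, ofCoord (F := F) 0 0 1 0 0⁆ ∧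
      δ (ofCoord 0 (x F 0) (x F 1) 0 0) = ⁅m, ofCoord (F := F) 0 (x F 0) (x F 1) 0 0⁆ := by
  have h5 := five_eq_zero F
  obtain ⟨m, hm₀, hm₁⟩ := exists_lie_eq_on_D δ
  let δ' : LieDerivation F (M F) (M F) := δ + LieDerivation.inner F (M F) (M F) m
  have hδ' (y : M F) : δ' y = δ y + ⁅y, m⁆ := rfl
  have h₀ : δ' (ofCoord 0 1 0 0 0) = 0 := by
    rw [hδ', hm₀, ← lie_skew, neg_add_cancel]
  have h₁ : δ' (ofCoord 0 0 1 0 0) = 0 := by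
    rw [hδ', hm₁, ← lie_skew, neg_add_cancel]
  obtain ⟨f, g₁, g₂, k₁, k₂, hz, hf, hg₁, hg₂, hk₁, hk₂⟩ :=
    exists_coord_of_lie_D_eq_zero (z := δ' (ofCoord 0 (x F 0) (x F 1) 0 0))
      (lie_D_apply_eq_zero h₀ (by rw [lie_D_zero]; simpa [D_x] using h₀))
      (lie_D_apply_eq_zero h₁ (by rw [lie_D_one]; simpa [D_x] using h₁))
  -- The solution of -[Euler, n] = z for z the constant element just found: each coordinate is
  -- divided by minus its eigenvalue, and -1/3 = -2 modulo 5. Constant coordinates make n commute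
  -- with D₁ and D₂, so the earlier normalization persists.
  let n : M F := ofCoord (-f) g₁ g₂ (-2 * k₁) (-2 * k₂)
  have hk (k : A F) (hk : ∀ i, D F i k = 0) (i : Fin 2) : D F i (-2 * k) = 0 := by
    simp [hk, D_two]
  refine ⟨m + n, ?_, ?_, ?_⟩
  · rw [add_lie, ← hm₀, ← lie_skew, lie_D_zero, map_neg, hf, hg₁, hg₂, hk _ hk₁, hk _ hk₂, neg_zero,
      ← zero_eq_ofCoord, neg_zero, add_zero]
  · rw [add_lie, ← hm₁, ← lie_skew, lie_D_one, map_neg, hf, hg₁, hg₂, hk _ hk₁, hk _ hk₂, neg_zero,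
      ← zero_eq_ofCoord, neg_zero, add_zero]
  · rw [hδ', ← lie_skew, ← sub_eq_add_neg, sub_eq_iff_eq_add'] at hz
    rw [hz, add_lie, ← lie_skew n,
      lie_euler_of_const (by simp [hf]) hg₁ hg₂ (hk _ hk₁) (hk _ hk₂), add_right_inj,
      eq_neg_iff_add_eq_zero, ofCoord_add, zero_eq_ofCoord, ofCoord_inj]
    refine ⟨by ring, by ring, by ring, ?_, ?_⟩
    · linear_combination -k₁ * h5
    · linear_combination -k₂ * h5

/-! ### Weights for the torus spanned by x₁D₁ and x₂D₂ -/

theorem nsmul_ofCoord (n : ℕ) (f g₁ g₂ h₁ h₂ : A F) :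
    n • ofCoord f g₁ g₂ h₁ h₂ = 
      ofCoord ((n : A F) * f) ((n : A F) * g₁) ((n : A F) * g₂) ((n : A F) * h₁) ((n : A F) * h₂) := by
  rw [← Nat.cast_smul_eq_nsmul F, smul_ofCoord]
  simp only [Algebra.smul_def, map_natCast]

section Weights

variable {f g₁ g₂ h₁ h₂ : A F} (hf : ∀ i, D F i f = 0) (hg₁ : ∀ i, D F i g₁ = 0)
  (hg₂ : ∀ i, D F i g₂ = 0) (hh₁ : ∀ i, D F i h₁ = 0) (hh₂ : ∀ i, D F i h₂ = 0)

include hf hg₁ hg₂ hh₁ hh₂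

/-- For x₁D₁ the elements 1, D₁, D₂, D₁~, D₂~ have weights -2, -1, 0, 1, 2. The factors n - weight
are written as natural numbers modulo 5, to suit `eq_zero_of_natCast_mul`. -/
theorem weight_zero_of_const {n : ℕ}
    (h : ⁅ofCoord (F := F) 0 (x F 0) 0 0 0, ofCoord f g₁ g₂ h₁ h₂⁆ = n • ofCoord f g₁ g₂ h₁ h₂) :
    ((n + 2 : ℕ) : A F) * f = 0 ∧ ((n + 1 : ℕ) : A F) * g₁ = 0 ∧ (n : A F) * g₂ = 0 ∧
      ((n + 4 : ℕ) : A F) * h₁ = 0 ∧ ((n + 3 : ℕ) : A F) * h₂ = 0 := by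
  have h5 := five_eq_zero F
  rw [lie_xD_zero_of_const hf hg₁ hg₂ hh₁ hh₂, nsmul_ofCoord, ofCoord_inj] at h
  obtain ⟨e₁, e₂, e₃, e₄, e₅⟩ := h
  push_cast
  refine ⟨?_, ?_, e₃.symm, ?_, ?_⟩
  · linear_combination -e₁
  · linear_combination -e₂
  · linear_combination -e₄ + h₁ * h5
  · linear_combination -e₅ + h₂ * h5

theorem weight_one_of_const {n : ℕ}
    (h : ⁅ofCoord (F := F) 0 0 (x F 1) 0 0, ofCoord f g₁ g₂ h₁ h₂⁆ = n • ofCoord f g₁ g₂ h₁ h₂) :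
    ((n + 2 : ℕ) : A F) * f = 0 ∧ (n : A F) * g₁ = 0 ∧ ((n + 1 : ℕ) : A F) * g₂ = 0 ∧
      ((n + 3 : ℕ) : A F) * h₁ = 0 ∧ ((n + 4 : ℕ) : A F) * h₂ = 0 := by
  have h5 := five_eq_zero F
  rw [lie_xD_one_of_const hf hg₁ hg₂ hh₁ hh₂, nsmul_ofCoord, ofCoord_inj] at h
  obtain ⟨e₁, e₂, e₃, e₄, e₅⟩ := h
  push_cast
  refine ⟨?_, e₂.symm, ?_, ?_, ?_⟩
  · linear_combination -e₁
  · linear_combination -e₃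
  · linear_combination -e₄ + h₁ * h5
  · linear_combination -e₅ + h₂ * h5

end Weights

/-- A derivation that kills `D₁, D₂` and the Euler field kills `x₁D₁` and `x₂D₂`. -/
theorem apply_xD_eq_zero {δ : LieDerivation F (M F) (M F)} (h₀ : δ (ofCoord 0 1 0 0 0) = 0)
    (h₁ : δ (ofCoord 0 0 1 0 0) = 0) (he : δ (ofCoord 0 (x F 0) (x F 1) 0 0) = 0) :
    δ (ofCoord 0 (x F 0) 0 0 0) = 0 ∧ δ (ofCoord 0 0 (x F 1) 0 0) = 0 := by
  have hz : δ (ofCoord 0 0 0 0 0) = 0 := by rw [← zero_eq_ofCoord, map_zero]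
  constructor
  -- Brackets of x₁D₁ with D₁ and D₂ are D₁ and 0, and x₁D₁ commutes with the Euler field. So its
  -- image under δ commutes with D₁, D₂ and the Euler field.
  · apply eq_zero_of_lie_euler
    · exact lie_D_apply_eq_zero h₀ (by rw [lie_D_zero]; simpa [D_x] using h₀)
    · exact lie_D_apply_eq_zero h₁ (by rw [lie_D_one]; simpa [D_x] using hz)
    · exact lie_D_apply_eq_zero he (by rw [lie_ofCoord]; simpa [D_x] using hz)
  · apply eq_zero_of_lie_euler
    · exact lie_D_apply_eq_zero h₀ (by rw [lie_D_zero]; simpa [D_x] using hz)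
    · exact lie_D_apply_eq_zero h₁ (by rw [lie_D_one]; simpa [D_x] using h₁)
    · exact lie_D_apply_eq_zero he (by rw [lie_ofCoord]; simpa [D_x] using hz)

/-! ### Functions all of whose associated elements are killed -/

/-- `δ` kills `f`, `fD₁`, `fD₂`, `fD₁~` and `fD₂~`. -/
structure Kills (δ : LieDerivation F (M F) (M F)) (f : A F) : Prop where
  fn : δ (ofCoord f 0 0 0 0) = 0
  vf_zero : δ (ofCoord 0 f 0 0 0) = 0
  vf_one : δ (ofCoord 0 0 f 0 0) = 0
  tvf_zero : δ (ofCoord 0 0 0 f 0) = 0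
  tvf_one : δ (ofCoord 0 0 0 0 f) = 0

section Killing

variable {δ : LieDerivation F (M F) (M F)}

theorem Kills.zero : Kills δ 0 := by
  constructor <;> rw [← zero_eq_ofCoord, map_zero]

theorem Kills.add {f g : A F} (hf : Kills δ f) (hg : Kills δ g) : Kills δ (f + g) := by
  constructor
  · simpa [ofCoord_add, hf.fn, hg.fn] using
      map_add δ (ofCoord f 0 0 0 0) (ofCoord g 0 0 0 0)
  · simpa [ofCoord_add, hf.vf_zero, hg.vf_zero] using
      map_add δ (ofCoord 0 f 0 0 0) (ofCoord 0 g 0 0 0)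
  · simpa [ofCoord_add, hf.vf_one, hg.vf_one] using
      map_add δ (ofCoord 0 0 f 0 0) (ofCoord 0 0 g 0 0)
  · simpa [ofCoord_add, hf.tvf_zero, hg.tvf_zero] using
      map_add δ (ofCoord 0 0 0 f 0) (ofCoord 0 0 0 g 0)
  · simpa [ofCoord_add, hf.tvf_one, hg.tvf_one] using
      map_add δ (ofCoord 0 0 0 0 f) (ofCoord 0 0 0 0 g)

theorem Kills.smul {f : A F} (c : F) (hf : Kills δ f) : Kills δ (c • f) := by
  constructor
  · simpa [smul_ofCoord, hf.fn] using map_smul δ c (ofCoord f 0 0 0 0)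
  · simpa [smul_ofCoord, hf.vf_zero] using map_smul δ c (ofCoord 0 f 0 0 0)
  · simpa [smul_ofCoord, hf.vf_one] using map_smul δ c (ofCoord 0 0 f 0 0)
  · simpa [smul_ofCoord, hf.tvf_zero] using map_smul δ c (ofCoord 0 0 0 f 0)
  · simpa [smul_ofCoord, hf.tvf_one] using map_smul δ c (ofCoord 0 0 0 0 f)

theorem Kills.natCast_mul {f : A F} (n : ℕ) (hf : Kills δ f) : Kills δ (n * f) := by
  have := hf.smul (n : F)
  rwa [Algebra.smul_def, map_natCast] at this

theorem eq_zero_of_forall_kills (h : ∀ f, Kills δ f) (y : M F) : δ y = 0 := by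
  have e : y = ofCoord y.fn 0 0 0 0 + ofCoord 0 (y.vf (x F 0)) 0 0 0
      + ofCoord 0 0 (y.vf (x F 1)) 0 0 + ofCoord 0 0 0 (y.tvf (x F 0)) 0
      + ofCoord 0 0 0 0 (y.tvf (x F 1)) := by
    simp only [ofCoord_add, zero_add, add_zero]
    exact eq_ofCoord y
  rw [e]
  simp only [map_add, (h _).fn, (h _).vf_zero, (h _).vf_one, (h _).tvf_zero, (h _).tvf_one,
    add_zero]

theorem apply_lie_eq_zero {a b : M F} (ha : δ a = 0) (hb : δ b = 0) : δ ⁅a, b⁆ = 0 := by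
  rw [LieDerivation.apply_lie_eq_add, ha, hb, lie_zero, zero_lie, add_zero]

/-- Derivatives of products of killed functions give killed elements of `W(2)~`. -/
theorem Kills.tvf_D_mul {f g : A F} (hf : Kills δ f) (hg : Kills δ g) (i : Fin 2) :
    δ (ofCoord 0 0 0 (D F i (f * g)) 0) = 0 ∧ δ (ofCoord 0 0 0 0 (D F i (f * g))) = 0 := by
  have h5 := five_eq_zero F
  obtain rfl | rfl : i = 0 ∨ i = 1 := by omega
  · constructor
    · have e : ofCoord 0 0 0 (D F 0 (f * g)) 0 = ⁅ofCoord 0 f 0 0 0, ofCoord 0 0 0 g 0⁆ := by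
        rw [lie_ofCoord, ofCoord_inj]
        simp
        ring
      rw [e]
      exact apply_lie_eq_zero hf.vf_zero hg.tvf_zero
    -- The D₁~ parts of the three brackets cancel and the D₂~ parts add up to 4D₁(fg); the outer
    -- factor 4 is the inverse of 4 modulo 5.
    · have e : ofCoord 0 0 0 0 (D F 0 (f * g)) = 4 • (⁅ofCoord 0 0 f 0 0, ofCoord 0 0 0 g 0⁆
          + ⁅ofCoord 0 g 0 0 0, ofCoord 0 0 0 0 f⁆
          + 2 • ⁅ofCoord 0 f 0 0 0, ofCoord 0 0 0 0 g⁆) := by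
        simp only [lie_ofCoord, ofCoord_add, nsmul_ofCoord, ofCoord_inj]
        simp only [map_zero, Derivation.leibniz, smul_eq_mul]
        push_cast
        refine ⟨by ring, by ring, by ring, by ring, ?_⟩
        linear_combination -3 * (f * D F 0 g + g * D F 0 f) * h5
      rw [e, map_nsmul, map_add, map_add, map_nsmul, apply_lie_eq_zero hf.vf_one hg.tvf_zero,
        apply_lie_eq_zero hg.vf_zero hf.tvf_one, apply_lie_eq_zero hf.vf_zero hg.tvf_one]
      simp
  · constructor
    · have e : ofCoord 0 0 0 (D F 1 (f * g)) 0 = 4 • (⁅ofCoord 0 f 0 0 0, ofCoord 0 0 0 0 g⁆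
          + ⁅ofCoord 0 0 g 0 0, ofCoord 0 0 0 f 0⁆
          + 2 • ⁅ofCoord 0 0 f 0 0, ofCoord 0 0 0 g 0⁆) := by
        simp only [lie_ofCoord, ofCoord_add, nsmul_ofCoord, ofCoord_inj]
        simp only [map_zero, Derivation.leibniz, smul_eq_mul]
        push_cast
        refine ⟨by ring, by ring, by ring, ?_, by ring⟩
        linear_combination -3 * (f * D F 1 g + g * D F 1 f) * h5
      rw [e, map_nsmul, map_add, map_add, map_nsmul, apply_lie_eq_zero hf.vf_zero hg.tvf_one,
        apply_lie_eq_zero hg.vf_one hf.tvf_zero, apply_lie_eq_zero hf.vf_one hg.tvf_zero]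
      simp
    · have e : ofCoord 0 0 0 0 (D F 1 (f * g)) = ⁅ofCoord 0 0 f 0 0, ofCoord 0 0 0 0 g⁆ := by
        rw [lie_ofCoord, ofCoord_inj]
        simp
        ring
      rw [e]
      exact apply_lie_eq_zero hf.vf_one hg.tvf_one

end Killing

/-! ### Derivations killing D₁, D₂, x₁D₁ and x₂D₂: degree zero -/

section Normalized

variable {δ : LieDerivation F (M F) (M F)} (h₀ : δ (ofCoord 0 1 0 0 0) = 0)
  (h₁ : δ (ofCoord 0 0 1 0 0) = 0) (hx₀ : δ (ofCoord 0 (x F 0) 0 0 0) = 0)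
  (hx₁ : δ (ofCoord 0 0 (x F 1) 0 0) = 0)

include h₀ h₁ hx₀ hx₁

/-- A derivation that kills d commutes with ad d. For d = D₁, D₂ this makes the coordinates of δ(y)
constant; for d = x₁D₁, x₂D₂ it gives δ(y) the same weight (a, b) as y. -/
theorem exists_coord_apply {y : M F} {a b : ℕ}
    (hy₀ : δ ⁅ofCoord (F := F) 0 1 0 0 0, y⁆ = 0) (hy₁ : δ ⁅ofCoord (F := F) 0 0 1 0 0, y⁆ = 0)
    (ha : ⁅ofCoord (F := F) 0 (x F 0) 0 0 0, y⁆ = a • y)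
    (hb : ⁅ofCoord (F := F) 0 0 (x F 1) 0 0, y⁆ = b • y) :
    ∃ f g₁ g₂ k₁ k₂ : A F, δ y = ofCoord f g₁ g₂ k₁ k₂ ∧ ((∀ i, D F i f = 0) ∧
      (∀ i, D F i g₁ = 0) ∧ (∀ i, D F i g₂ = 0) ∧ (∀ i, D F i k₁ = 0) ∧ ∀ i, D F i k₂ = 0) ∧
      (((a + 2 : ℕ) : A F) * f = 0 ∧ ((a + 1 : ℕ) : A F) * g₁ = 0 ∧ (a : A F) * g₂ = 0 ∧
        ((a + 4 : ℕ) : A F) * k₁ = 0 ∧ ((a + 3 : ℕ) : A F) * k₂ = 0) ∧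
      ((b + 2 : ℕ) : A F) * f = 0 ∧ (b : A F) * g₁ = 0 ∧ ((b + 1 : ℕ) : A F) * g₂ = 0 ∧
        ((b + 3 : ℕ) : A F) * k₁ = 0 ∧ ((b + 4 : ℕ) : A F) * k₂ = 0 := by
  obtain ⟨f, g₁, g₂, k₁, k₂, hz, hf, hg₁, hg₂, hk₁, hk₂⟩ :=
    exists_coord_of_lie_D_eq_zero (lie_D_apply_eq_zero h₀ hy₀) (lie_D_apply_eq_zero h₁ hy₁)
  have ea := congrArg δ ha
  have eb := congrArg δ hb
  rw [LieDerivation.apply_lie_eq_add, hx₀, zero_lie, add_zero, map_nsmul, hz] at ea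
  rw [LieDerivation.apply_lie_eq_add, hx₁, zero_lie, add_zero, map_nsmul, hz] at eb
  exact ⟨f, g₁, g₂, k₁, k₂, hz, ⟨hf, hg₁, hg₂, hk₁, hk₂⟩,
    weight_zero_of_const hf hg₁ hg₂ hk₁ hk₂ ea, weight_one_of_const hf hg₁ hg₂ hk₁ hk₂ eb⟩

/-- Weights leave only δ(1) = α, δ(D₁~) = βD₁~, δ(D₂~) = γD₂~. The brackets [1, D₁~] = D₁, [1, D₂~]
= D₂, [D₁~, D₂~] = 1 give α + β = 0, α + γ = 0, β + γ = α, hence 3α = 0. -/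
theorem kills_one : Kills δ 1 := by
  have h5 := five_eq_zero F
  have hz : δ (ofCoord 0 0 0 0 0) = 0 := by rw [← zero_eq_ofCoord, map_zero]
  obtain ⟨α, g₁, g₂, k₁, k₂, hu, -, ⟨-, w₁, w₂, w₃, w₄⟩, -⟩ :=
    exists_coord_apply h₀ h₁ hx₀ hx₁ (y := ofCoord 1 0 0 0 0) (a := 3) (b := 3)
      (by rw [lie_D_zero]; simpa using hz) (by rw [lie_D_one]; simpa using hz)
      (by
        rw [lie_ofCoord, nsmul_ofCoord, ofCoord_inj]
        simp [D_x]
        linear_combination -h5)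
      (by
        rw [lie_ofCoord, nsmul_ofCoord, ofCoord_inj]
        simp [D_x]
        linear_combination -h5)
  obtain rfl := eq_zero_of_natCast_mul (by norm_num) w₁
  obtain rfl := eq_zero_of_natCast_mul (by norm_num) w₂
  obtain rfl := eq_zero_of_natCast_mul (by norm_num) w₃
  obtain rfl := eq_zero_of_natCast_mul (by norm_num) w₄
  obtain ⟨f, g₁, g₂, β, k₂, hv₀, -, ⟨w₀, w₁, w₂, -, w₄⟩, -⟩ :=
    exists_coord_apply h₀ h₁ hx₀ hx₁ (y := ofCoord 0 0 0 1 0) (a := 1) (b := 2)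
      (by rw [lie_D_zero]; simpa using hz) (by rw [lie_D_one]; simpa using hz)
      (by
        rw [lie_ofCoord, nsmul_ofCoord, ofCoord_inj]
        simp [D_x]
        ring)
      (by
        rw [lie_ofCoord, nsmul_ofCoord, ofCoord_inj]
        simp [D_x])
  obtain rfl := eq_zero_of_natCast_mul (by norm_num) w₀
  obtain rfl := eq_zero_of_natCast_mul (by norm_num) w₁
  obtain rfl := eq_zero_of_natCast_mul (by norm_num) w₂
  obtain rfl := eq_zero_of_natCast_mul (by norm_num) w₄
  obtain ⟨f, g₁, g₂, k₁, γ, hv₁, -, -, ⟨w₀, w₁, w₂, w₃, -⟩⟩ :=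
    exists_coord_apply h₀ h₁ hx₀ hx₁ (y := ofCoord 0 0 0 0 1) (a := 2) (b := 1)
      (by rw [lie_D_zero]; simpa using hz) (by rw [lie_D_one]; simpa using hz)
      (by
        rw [lie_ofCoord, nsmul_ofCoord, ofCoord_inj]
        simp [D_x])
      (by
        rw [lie_ofCoord, nsmul_ofCoord, ofCoord_inj]
        simp [D_x]
        ring)
  obtain rfl := eq_zero_of_natCast_mul (by norm_num) w₀
  obtain rfl := eq_zero_of_natCast_mul (by norm_num) w₁
  obtain rfl := eq_zero_of_natCast_mul (by norm_num) w₂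
  obtain rfl := eq_zero_of_natCast_mul (by norm_num) w₃
  have e₀ : ⁅ofCoord (F := F) 1 0 0 0 0, ofCoord (F := F) 0 0 0 1 0⁆ = ofCoord 0 1 0 0 0 := by
    rw [lie_ofCoord]; simp
  have e₁ : ⁅ofCoord (F := F) 1 0 0 0 0, ofCoord (F := F) 0 0 0 0 1⁆ = ofCoord 0 0 1 0 0 := by
    rw [lie_ofCoord]; simp
  have e₂ : ⁅ofCoord (F := F) 0 0 0 1 0, ofCoord (F := F) 0 0 0 0 1⁆ = ofCoord 1 0 0 0 0 := by
    rw [lie_ofCoord]; simp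
  replace e₀ := congrArg δ e₀
  replace e₁ := congrArg δ e₁
  replace e₂ := congrArg δ e₂
  rw [LieDerivation.apply_lie_eq_add, hu, hv₀, h₀, lie_ofCoord, lie_ofCoord, ofCoord_add,
    zero_eq_ofCoord, ofCoord_inj] at e₀
  rw [LieDerivation.apply_lie_eq_add, hu, hv₁, h₁, lie_ofCoord, lie_ofCoord, ofCoord_add,
    zero_eq_ofCoord, ofCoord_inj] at e₁
  rw [LieDerivation.apply_lie_eq_add, hu, hv₀, hv₁, lie_ofCoord, lie_ofCoord, ofCoord_add,
    ofCoord_inj] at e₂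
  replace e₀ := e₀.2.1
  replace e₁ := e₁.2.2.1
  replace e₂ := e₂.1
  simp at e₀ e₁ e₂
  have hα : α = 0 := eq_zero_of_natCast_mul (n := 3) (by norm_num) (by
    push_cast; linear_combination e₀ + e₁ - e₂)
  subst hα
  obtain rfl : β = 0 := by linear_combination e₀
  obtain rfl : γ = 0 := by linear_combination e₁
  exact ⟨by rw [hu, zero_eq_ofCoord], h₀, h₁, by rw [hv₀, zero_eq_ofCoord],
    by rw [hv₁, zero_eq_ofCoord]⟩

end Normalized

/-! ### Induction on the degree of monomials -/

section Monomials

variable {δ : LieDerivation F (M F) (M F)} (h₀ : δ (ofCoord 0 1 0 0 0) = 0)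
  (h₁ : δ (ofCoord 0 0 1 0 0) = 0) (hx₀ : δ (ofCoord 0 (x F 0) 0 0 0) = 0)
  (hx₁ : δ (ofCoord 0 0 (x F 1) 0 0) = 0)

include h₀ h₁ hx₀ hx₁

/-- A weight vector `f` of positive degree `(a, b)` is killed if its derivatives are, except
possibly for the action on `fD₁~` and `fD₂~` in the degrees `(3, 3)`, `(4, 2)` and `(2, 4)`. -/
theorem kills_of_kills_D {f : A F} {a b : ℕ} (ha : x F 0 * D F 0 f = (a : A F) * f)
    (hb : x F 1 * D F 1 f = (b : A F) * f) (ha5 : a < 5) (hb5 : b < 5) (hab : 0 < a + b)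
    (hD₀ : Kills δ (D F 0 f)) (hD₁ : Kills δ (D F 1 f))
    (hexc : a = 3 ∧ b = 3 ∨ a = 4 ∧ b = 2 ∨ a = 2 ∧ b = 4 →
      δ (ofCoord 0 0 0 f 0) = 0 ∧ δ (ofCoord 0 0 0 0 f) = 0) : Kills δ f := by
  have h5 := five_eq_zero F
  have hone := kills_one h₀ h₁ hx₀ hx₁
  obtain ⟨α, g₁, g₂, k₁, k₂, hu, ⟨cα, cg₁, cg₂, ck₁, ck₂⟩, ⟨wa, -⟩, ⟨wb, -⟩⟩ :=
    exists_coord_apply h₀ h₁ hx₀ hx₁ (y := ofCoord f 0 0 0 0) (a := a + 3) (b := b + 3)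
      (by rw [lie_D_zero]; simpa using hD₀.fn) (by rw [lie_D_one]; simpa using hD₁.fn)
      (by
        rw [lie_ofCoord, nsmul_ofCoord, ofCoord_inj]
        simp [D_x]
        linear_combination ha - f * h5)
      (by
        rw [lie_ofCoord, nsmul_ofCoord, ofCoord_inj]
        simp [D_x]
        linear_combination hb - f * h5)
  -- The weights (a+3, b+3) of f and (3, 3) of 1 agree modulo 5 only for a = b = 0.
  obtain rfl : α = 0 := by
    by_cases h : a = 0
    · exact eq_zero_of_natCast_mul (by omega) wb
    · exact eq_zero_of_natCast_mul (by omega) wa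
  obtain ⟨ν₀, p₀, q₀, r₀, s₀, hv₀, ⟨cν₀, cp₀, cq₀, cr₀, cs₀⟩, ⟨-, wp₀a, wq₀a, -⟩, -, wp₀b, wq₀b, -⟩ :=
    exists_coord_apply h₀ h₁ hx₀ hx₁ (y := ofCoord 0 0 0 f 0) (a := a + 1) (b := b + 2)
      (by rw [lie_D_zero]; simpa using hD₀.tvf_zero) (by rw [lie_D_one]; simpa using hD₁.tvf_zero)
      (by
        rw [lie_ofCoord, nsmul_ofCoord, ofCoord_inj]
        simp [D_x]
        linear_combination ha)
      (by
        rw [lie_ofCoord, nsmul_ofCoord, ofCoord_inj]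
        simp [D_x]
        linear_combination hb)
  obtain ⟨ν₁, p₁, q₁, r₁, s₁, hv₁, ⟨cν₁, cp₁, cq₁, cr₁, cs₁⟩, ⟨-, wp₁a, wq₁a, -⟩, -, wp₁b, wq₁b, -⟩ :=
    exists_coord_apply h₀ h₁ hx₀ hx₁ (y := ofCoord 0 0 0 0 f) (a := a + 2) (b := b + 1)
      (by rw [lie_D_zero]; simpa using hD₀.tvf_one) (by rw [lie_D_one]; simpa using hD₁.tvf_one)
      (by
        rw [lie_ofCoord, nsmul_ofCoord, ofCoord_inj]
        simp [D_x]
        linear_combination ha)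
      (by
        rw [lie_ofCoord, nsmul_ofCoord, ofCoord_inj]
        simp [D_x]
        linear_combination hb)
  -- `[1, f]` has coefficients among the derivatives of `f`
  have e : δ ⁅ofCoord (F := F) 1 0 0 0 0, ofCoord f 0 0 0 0⁆ = 0 := by
    have e' : ⁅ofCoord (F := F) 1 0 0 0 0, ofCoord f 0 0 0 0⁆ =
        3 • ofCoord 0 0 0 (D F 1 f) 0 + 2 • ofCoord 0 0 0 0 (D F 0 f) := by
      simp only [lie_ofCoord, ofCoord_add, nsmul_ofCoord, ofCoord_inj]
      simp
      linear_combination -D F 1 f * h5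
    rw [e', map_add, map_nsmul, map_nsmul, hD₁.tvf_zero, hD₀.tvf_one]
    simp
  rw [LieDerivation.apply_lie_eq_add, hone.fn, zero_lie, add_zero, hu, lie_ofCoord, zero_eq_ofCoord,
    ofCoord_inj] at e
  obtain rfl : k₁ = 0 := by simpa using e.2.1
  obtain rfl : k₂ = 0 := by simpa using e.2.2.1
  -- Now δ(f) is a vector field with constant coefficients, which commutes with D₁~; and fD₁ = [f,
  -- D₁~].
  have hw₀ : δ (ofCoord 0 f 0 0 0) = 0 := by
    have e : ⁅ofCoord f 0 0 0 0, ofCoord (F := F) 0 0 0 1 0⁆ = ofCoord 0 f 0 0 0 := by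
      rw [lie_ofCoord]; simp
    rw [← e, LieDerivation.apply_lie_eq_add, hone.tvf_zero, lie_zero, zero_add, hu, lie_ofCoord,
      zero_eq_ofCoord, ofCoord_inj]
    simp [cg₁, cg₂]
  have hw₁ : δ (ofCoord 0 0 f 0 0) = 0 := by
    have e : ⁅ofCoord f 0 0 0 0, ofCoord (F := F) 0 0 0 0 1⁆ = ofCoord 0 0 f 0 0 := by
      rw [lie_ofCoord]; simp
    rw [← e, LieDerivation.apply_lie_eq_add, hone.tvf_one, lie_zero, zero_add, hu, lie_ofCoord,
      zero_eq_ofCoord, ofCoord_inj]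
    simp [cg₁, cg₂]
  have e₀ : ⁅ofCoord (F := F) 1 0 0 0 0, ofCoord 0 0 0 f 0⁆ = ofCoord 0 f 0 0 0 := by
    rw [lie_ofCoord]; simp
  have e₁ : ⁅ofCoord (F := F) 1 0 0 0 0, ofCoord 0 0 0 0 f⁆ = ofCoord 0 0 f 0 0 := by
    rw [lie_ofCoord]; simp
  replace e₀ := congrArg δ e₀
  replace e₁ := congrArg δ e₁
  rw [LieDerivation.apply_lie_eq_add, hone.fn, zero_lie, add_zero, hw₀, hv₀, lie_ofCoord,
    zero_eq_ofCoord, ofCoord_inj] at e₀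
  rw [LieDerivation.apply_lie_eq_add, hone.fn, zero_lie, add_zero, hw₁, hv₁, lie_ofCoord,
    zero_eq_ofCoord, ofCoord_inj] at e₁
  obtain rfl : r₀ = 0 := by simpa using e₀.2.1
  obtain rfl : s₀ = 0 := by simpa using e₀.2.2.1
  obtain rfl : r₁ = 0 := by simpa using e₁.2.1
  obtain rfl : s₁ = 0 := by simpa using e₁.2.2.1
  -- Two expressions for f: [fD₁~, D₂~] puts δ(f) in the D₂ direction, [D₁~, fD₂~] puts it in the D₁
  -- direction, so δ(f) = 0.
  have e₂ : ⁅ofCoord 0 0 0 f 0, ofCoord (F := F) 0 0 0 0 1⁆ = ofCoord f 0 0 0 0 := by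
    rw [lie_ofCoord]; simp
  have e₃ : ⁅ofCoord (F := F) 0 0 0 1 0, ofCoord 0 0 0 0 f⁆ = ofCoord f 0 0 0 0 := by
    rw [lie_ofCoord]; simp
  replace e₂ := congrArg δ e₂
  replace e₃ := congrArg δ e₃
  rw [LieDerivation.apply_lie_eq_add, hone.tvf_one, lie_zero, zero_add, hu, hv₀, lie_ofCoord,
    ofCoord_inj] at e₂
  rw [LieDerivation.apply_lie_eq_add, hone.tvf_zero, zero_lie, add_zero, hu, hv₁, lie_ofCoord,
    ofCoord_inj] at e₃
  obtain rfl : g₁ = 0 := by simpa using e₂.2.1.symm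
  obtain rfl : g₂ = 0 := by simpa using e₃.2.2.1.symm
  obtain rfl : ν₀ = 0 := by simpa using e₂.2.2.1
  obtain rfl : ν₁ = 0 := by simpa using e₃.2.1
  have hv : δ (ofCoord 0 0 0 f 0) = 0 ∧ δ (ofCoord 0 0 0 0 f) = 0 := by
    by_cases hx : a = 3 ∧ b = 3 ∨ a = 4 ∧ b = 2 ∨ a = 2 ∧ b = 4
    · exact hexc hx
    -- Only D₁ and D₂ components are left. Modulo 5, the weight of fD₁~ meets that of D₁ in degree
    -- (3, 3) and of D₂ in (4, 2); the weight of fD₂~ meets them in (2, 4) and (3, 3). Elsewhere one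
    -- of the two factors is prime to 5.
    have cancel {m n : ℕ} {p : A F} (hm : (m : A F) * p = 0) (hn : (n : A F) * p = 0)
        (hmn : ¬ (5 ∣ m ∧ 5 ∣ n)) : p = 0 := by
      by_cases h : 5 ∣ m
      · exact eq_zero_of_natCast_mul (fun h' => hmn ⟨h, h'⟩) hn
      · exact eq_zero_of_natCast_mul h hm
    rw [hv₀, hv₁, cancel wp₀a wp₀b (by omega), cancel wq₀a wq₀b (by omega),
      cancel wp₁a wp₁b (by omega), cancel wq₁a wq₁b (by omega), zero_eq_ofCoord]
    exact ⟨rfl, rfl⟩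
  exact ⟨by rw [hu, zero_eq_ofCoord], hw₀, hw₁, hv.1, hv.2⟩

theorem kills_monomial (a b : ℕ) : Kills δ (x F 0 ^ a * x F 1 ^ b) := by
  induction h : a + b using Nat.strong_induction_on generalizing a b with
  | _ n ih =>
  by_cases ha5 : 5 ≤ a
  · rw [← Nat.sub_add_cancel ha5, pow_add, x_pow_five, mul_zero, zero_mul]
    exact Kills.zero
  by_cases hb5 : 5 ≤ b
  · rw [← Nat.sub_add_cancel hb5, pow_add, x_pow_five, mul_zero, mul_zero]
    exact Kills.zero
  by_cases hn : n = 0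
  · obtain ⟨rfl, rfl⟩ : a = 0 ∧ b = 0 := by omega
    simpa using kills_one h₀ h₁ hx₀ hx₁
  have hD₀ : D F 0 (x F 0 ^ a * x F 1 ^ b) = (a : A F) * (x F 0 ^ (a - 1) * x F 1 ^ b) := by
    simp [Derivation.leibniz, Derivation.leibniz_pow, D_x]
    ring
  have hD₁ : D F 1 (x F 0 ^ a * x F 1 ^ b) = (b : A F) * (x F 0 ^ a * x F 1 ^ (b - 1)) := by
    simp [Derivation.leibniz, Derivation.leibniz_pow, D_x]
    ring
  apply kills_of_kills_D h₀ h₁ hx₀ hx₁ (a := a) (b := b)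
  · rw [hD₀]
    rcases a with _ | a
    · simp
    · rw [Nat.add_sub_cancel]; ring
  · rw [hD₁]
    rcases b with _ | b
    · simp
    · rw [Nat.add_sub_cancel]; ring
  · omega
  · omega
  · omega
  · rw [hD₀]
    rcases a with _ | a
    · simpa using Kills.zero
    · exact (ih _ (by omega) _ _ rfl).natCast_mul _
  · rw [hD₁]
    rcases b with _ | b
    · simpa using Kills.zero
    · exact (ih _ (by omega) _ _ rfl).natCast_mul _
  · have h5 := five_eq_zero F
    rintro (⟨rfl, rfl⟩ | ⟨rfl, rfl⟩ | ⟨rfl, rfl⟩)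
    -- In the exceptional degrees the monomial is a derivative of a product of monomials of degrees
    -- 2 and 5, already killed by induction. Here x₁³x₂³ = D₁(4x₁² · x₁²x₂³) since 16 = 1 modulo 5;
    -- in the other two cases the factor is 6 = 1.
    · have e := ((ih 2 (by omega) 2 0 rfl).natCast_mul 4).tvf_D_mul (ih 5 (by omega) 2 3 rfl) 0
      convert e using 4 <;>
      · simp [Derivation.leibniz, Derivation.leibniz_pow, D_x, D_two, D_four]
        linear_combination -3 * x F 0 ^ 3 * x F 1 ^ 3 * h5
    · have e := ((ih 2 (by omega) 0 2 rfl).natCast_mul 2).tvf_D_mul (ih 5 (by omega) 4 1 rfl) 1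
      convert e using 4 <;>
      · simp [Derivation.leibniz, Derivation.leibniz_pow, D_x, D_two, D_four]
        linear_combination -x F 0 ^ 4 * x F 1 ^ 2 * h5
    · have e := ((ih 2 (by omega) 2 0 rfl).natCast_mul 2).tvf_D_mul (ih 5 (by omega) 1 4 rfl) 0
      convert e using 4 <;>
      · simp [Derivation.leibniz, Derivation.leibniz_pow, D_x, D_two, D_four]
        linear_combination -x F 0 ^ 2 * x F 1 ^ 4 * h5

/-- A derivation that kills `D₁`, `D₂`, `x₁D₁` and `x₂D₂` is zero. -/
theorem eq_zero_of_apply_D_xD (y : M F) : δ y = 0 := by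
  refine eq_zero_of_forall_kills (fun f => ?_) y
  obtain ⟨f, rfl⟩ := mk_surjective F f
  induction f using MvPolynomial.induction_on' with
  | monomial s c =>
    have e : mk F (MvPolynomial.monomial s c) = c • (x F 0 ^ s 0 * x F 1 ^ s 1) := by
      rw [MvPolynomial.monomial_eq, Finsupp.prod_fintype _ _ (by simp), Fin.prod_univ_two,
        ← MvPolynomial.smul_eq_C_mul, map_smul, map_mul, map_pow, map_pow]
      rfl
    rw [e]
    exact (kills_monomial h₀ h₁ hx₀ hx₁ _ _).smul c
  | add p q hp hq => rw [map_add]; exact hp.add hq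

end Monomials

/-! ### Conclusion for derivations and for H¹ -/

/-- Every derivation of the Melikian algebra is inner. -/
theorem exists_apply_eq_lie (δ : LieDerivation F (M F) (M F)) :
    ∃ m : M F, ∀ y : M F, δ y = ⁅m, y⁆ := by
  obtain ⟨m, h₀, h₁, he⟩ := exists_lie_eq_on_D_euler δ
  let δ' : LieDerivation F (M F) (M F) := δ + LieDerivation.inner F (M F) (M F) m
  have hδ' {y : M F} : δ' y = 0 ↔ δ y = ⁅m, y⁆ := by
    change δ y + ⁅y, m⁆ = 0 ↔ _
    rw [← lie_skew, ← sub_eq_add_neg, sub_eq_zero]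
  obtain ⟨hx₀, hx₁⟩ := apply_xD_eq_zero (hδ'.mpr h₀) (hδ'.mpr h₁) (hδ'.mpr he)
  exact ⟨m, fun y => hδ'.mp (eq_zero_of_apply_D_xD (hδ'.mpr h₀) (hδ'.mpr h₁) hx₀ hx₁ y)⟩

end Melikian

end

theorem mainTheorem2 (F : Type*) [Field F] [CharP F 5] :
    Subsingleton (Melikian.H1 F (Melikian.M F) (Melikian.M F)) ∧
      ∀ δ : LieDerivation F (Melikian.M F) (Melikian.M F),
        ∃ m : Melikian.M F, ∀ y : Melikian.M F, δ y = ⁅m, y⁆ := by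
  refine ⟨?_, Melikian.exists_apply_eq_lie⟩
  rw [Submodule.Quotient.subsingleton_iff, Submodule.submoduleOf_eq_top]
  intro f hf
  have hf' (y z : Melikian.M F) : f ⁅y, z⁆ = ⁅y, f z⁆ - ⁅z, f y⁆ := by
    have := congrArg (fun g => g y z) (LinearMap.mem_ker.mp hf)
    rw [LieModule.Cohomology.d₁₂_apply_apply] at this
    exact (sub_eq_zero.mp this).symm
  obtain ⟨m, hm⟩ := Melikian.exists_apply_eq_lie ⟨f, hf'⟩
  -- The differential sends v to y ↦ [y, v], so [m, ·] is the coboundary of -m.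
  refine ⟨-m, LinearMap.ext fun y => ?_⟩
  change ⁅y, -m⁆ = f y
  rw [lie_neg, lie_skew]
  exact (hm y).symm
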